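/- Consider $m$ views of $n$ points in $\mathbb{R}^d$: a bipartite graph $\Gamma$ with edge set $E(\Gamma)\subseteq[1,n]\times[1,m]$, where $(k,i)\in E(\Gamma)$ means that point $k$ lies in view $i$, and for each $(k,i)\in E(\Gamma)$ a vector $\mathbf{x}_{k,i}\in\mathbb{R}^d$ of local coordinates. For $\mathbf{S}=(\mathbf{S}_i)_1^m\in\mathbb{O}(d)^m$ put $$F(\mathbf{S})=\min_{(\mathbf{t}_i)_1^m,\,(\mathbf{x}_k)_1^n}\ \sum_{(k,i)\in E(\Gamma)}\bigl\|(\mathbf{S}_i^T\mathbf{x}_{k,i}+\mathbf{t}_i)-\mathbf{x}_k\bigr\|_2^2 ,$$ where $\mathbf{t}_i,\mathbf{x}_k$ range over $\mathbb{R}^d$. $\mathbf{S}$ is a perfect alignment if $F(\mathbf{S})=0$. Let $\mathbf{S}$ be a perfect alignment and let $(\mathbf{t}_i),(\mathbf{x}_k)$ be any minimizers for $\mathbf{S}$, so that $\mathbf{S}_i^T\mathbf{x}_{k,i}+\mathbf{t}_i=\mathbf{x}_k$ for all $(k,i)\in E(\Gamma)$. For sets of views $A,B$ let $\mathbf{B}(\mathbf{S})_{A,B}$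 be the $d\times n'$ matrix whose columns are the aligned points $\mathbf{x}_k$ for the $n'$ indices $k$ that lie in some view of $A$ and also in some view of $B$, and let $\overline{\mathbf{B}(\mathbf{S})}_{A,B}=\mathbf{B}(\mathbf{S})_{A,B}\bigl(\mathbf{I}_{n'}-\tfrac1{n'}\mathbf{1}_{n'}\mathbf{1}_{n'}^T\bigr)$ be the centred matrix (of rank $0$ if $n'=0$). Given a partition of the set of views, form the graph whose vertices are the classes of the partition, two distinct classes $A,B$ being adjacent iff $\operatorname{rank}\overline{\mathbf{B}(\mathbf{S})}_{A,B}\ge d$; then coarsen the partition by merging all classes that lie in the same connected component of this graph. Start with the partition of the $m$ views into singletons (the corresponding graph is $\overline{\mathbb{G}}$), repeat until no two classes can be merged, and let $\overline{\mathbb{G}}^*(\mathbf{S})$ be the graph so obtained. **Theorem.** If $\overline{\mathbb{G}}^*(\mathbf{S})$ has exactly one vertex, then the perfect alignment $\mathbf{S}$ is unique up to a global orthogonal transformation: for every perfect alignment $\mathbf{O}\in\mathbb{O}(d)^m$ there is $\mathbf{Q}\in\mathbb{O}(d)$ with $\mathbf{O}_i=\mathbf{S}_i\mathbf{Q}$ for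 all $i\in[1,m]$. -/

import Mathlib

/-- `m` views of `n` points in dimension `d`.  `edges` is the edge set `E(Γ)` of the bipartite
correspondence graph: `(k, i) ∈ edges` means that the `k`-th point lies in the `i`-th view.
`coord k i` is the vector `x_{k,i}` of local coordinates of the `k`-th point in the `i`-th view;
its value is never used when `(k, i) ∉ edges`. -/
structure Views (d m n : ℕ) where
  edges : Finset (Fin n × Fin m)
  coord : Fin n → Fin m → EuclideanSpace ℝ (Fin d)

namespace Views

variable {d m n : ℕ} (V : Views d m n)

/-- The alignment error
`∑_{(k,i) ∈ E(Γ)} ‖(S_iᵀ x_{k,i} + t_i) - x_k‖²` of orthogonal matrices `S_i`, translations `t_i`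
and common positions `x_k` of the points. -/
noncomputable def alignmentError (S : Fin m → Matrix.orthogonalGroup (Fin d) ℝ)
    (t : Fin m → EuclideanSpace ℝ (Fin d)) (x : Fin n → EuclideanSpace ℝ (Fin d)) : ℝ :=
  ∑ e ∈ V.edges,
    ‖(Matrix.toEuclideanLin (S e.2 : Matrix (Fin d) (Fin d) ℝ).transpose (V.coord e.1 e.2) + t e.2)
      - x e.1‖ ^ 2

/-- The objective `F(S)`: the alignment error of `S`, minimised over the translations and the
positions of the points. -/
noncomputable def objective (S : Fin m → Matrix.orthogonalGroup (Fin d) ℝ) : ℝ :=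
  ⨅ p : (Fin m → EuclideanSpace ℝ (Fin d)) × (Fin n → EuclideanSpace ℝ (Fin d)),
    V.alignmentError S p.1 p.2

/-- `(t, x)` are optimal translations and an optimal realization of the points for `S`. -/
def IsOptimalRealization (S : Fin m → Matrix.orthogonalGroup (Fin d) ℝ)
    (t : Fin m → EuclideanSpace ℝ (Fin d)) (x : Fin n → EuclideanSpace ℝ (Fin d)) : Prop :=
  V.alignmentError S t x = V.objective S

theorem exists_min_norm_sub {M F : Type*} [AddCommGroup M] [Module ℝ M] [NormedAddCommGroup F]
    [InnerProductSpace ℝ F] [FiniteDimensional ℝ F] (L : M →ₗ[ℝ] F) (v : F) :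
    ∃ p, ∀ q, ‖v - L p‖ ≤ ‖v - L q‖ := by
  obtain ⟨w, ⟨p, rfl⟩, hp⟩ := Submodule.exists_norm_eq_iInf_of_complete_subspace
    (LinearMap.range L) (Submodule.complete_of_finiteDimensional _) v
  refine ⟨p, fun q => ?_⟩
  rw [hp]
  exact ciInf_le (f := fun w : LinearMap.range L => ‖v - w‖)
    ⟨0, by rintro _ ⟨w, rfl⟩; exact norm_nonneg _⟩ ⟨L q, q, rfl⟩

/-- The infimum in `objective` is a minimum. -/
theorem exists_isOptimalRealization (S : Fin m → Matrix.orthogonalGroup (Fin d) ℝ) :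
    ∃ t x, V.IsOptimalRealization S t x := by
  let E := EuclideanSpace ℝ (Fin d)
  let L : ((Fin m → E) × (Fin n → E)) →ₗ[ℝ] PiLp 2 (fun _ : V.edges => E) :=
    { toFun := fun p => WithLp.toLp 2 fun e => p.2 e.1.1 - p.1 e.1.2
      map_add' := fun p q => by
        ext e : 1
        simp only [Prod.fst_add, Prod.snd_add, Pi.add_apply, PiLp.add_apply]
        abel
      map_smul' := fun c p => by
        ext e : 1
        simp [smul_sub] }
  let v : PiLp 2 (fun _ : V.edges => E) := WithLp.toLp 2 fun e =>
    Matrix.toEuclideanLin (S e.1.2 : Matrix (Fin d) (Fin d) ℝ).transpose (V.coord e.1.1 e.1.2)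
  have herr : ∀ p : (Fin m → E) × (Fin n → E), V.alignmentError S p.1 p.2 = ‖v - L p‖ ^ 2 := by
    intro p
    rw [PiLp.norm_sq_eq_of_L2, alignmentError, ← Finset.sum_coe_sort V.edges]
    refine Finset.sum_congr rfl fun e _ => ?_
    simp only [v, L, LinearMap.coe_mk, AddHom.coe_mk, PiLp.sub_apply]
    congr 2
    abel
  obtain ⟨p, hp⟩ := exists_min_norm_sub L v
  have hmin : ∀ q : (Fin m → E) × (Fin n → E),
      V.alignmentError S p.1 p.2 ≤ V.alignmentError S q.1 q.2 := by
    intro q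
    rw [herr, herr]
    exact pow_le_pow_left₀ (norm_nonneg _) (hp q) 2
  refine ⟨p.1, p.2, le_antisymm (le_ciInf hmin) ?_⟩
  exact ciInf_le (f := fun q : (Fin m → E) × (Fin n → E) => V.alignmentError S q.1 q.2)
    ⟨_, by rintro _ ⟨q, rfl⟩; exact hmin q⟩ p

/-- A perfect alignment is one with zero alignment error. -/
def IsPerfectAlignment (S : Fin m → Matrix.orthogonalGroup (Fin d) ℝ) : Prop :=
  V.objective S = 0

/-- `S` is the unique perfect alignment, up to the right action `S ↦ (S_i Q)_i` of `O(d)`. -/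
def IsUniquePerfectAlignment (S : Fin m → Matrix.orthogonalGroup (Fin d) ℝ) : Prop :=
  V.IsPerfectAlignment S ∧
    ∀ O : Fin m → Matrix.orthogonalGroup (Fin d) ℝ, V.IsPerfectAlignment O →
      ∃ Q : Matrix.orthogonalGroup (Fin d) ℝ, ∀ i, O i = S i * Q

open Classical in
/-- The points that lie in some view of `A` and also in some view of `B`. -/
noncomputable def overlap (A B : Set (Fin m)) : Finset (Fin n) :=
  {k | (∃ i ∈ A, (k, i) ∈ V.edges) ∧ ∃ j ∈ B, (k, j) ∈ V.edges}

theorem overlap_comm (A B : Set (Fin m)) : V.overlap A B = V.overlap B A := by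
  ext k
  simp only [overlap, Finset.mem_filter, Finset.mem_univ, true_and]
  exact and_comm

/-- The centred matrix of the points of `P`: its columns are the positions `x_k`, `k ∈ P`, minus
their mean.  If `X` is the matrix with columns `x_k` and `n'` is the number of elements of `P`, this
is `X (I - (1/n') 1 1ᵀ)`. -/
noncomputable def centredPointMatrix (x : Fin n → EuclideanSpace ℝ (Fin d))
    (P : Finset (Fin n)) : Matrix (Fin d) P ℝ :=
  Matrix.of fun a k => x k a - (1 / (P.card : ℝ)) * ∑ l ∈ P, x l a

/-- Given a partition `s` of the set of views, merge each class into one view.  The merged views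
are the vertices of this graph, and two of them are adjacent when the centred matrix of the
aligned points in their overlap has rank at least `d`.  When `s` is the partition into singletons,
the vertices are the views themselves. -/
noncomputable def uniquenessGraph (x : Fin n → EuclideanSpace ℝ (Fin d)) (s : Setoid (Fin m)) :
    SimpleGraph (Quotient s) where
  Adj a b := a ≠ b ∧
    d ≤ (centredPointMatrix x
      (V.overlap {i | Quotient.mk s i = a} {j | Quotient.mk s j = b})).rank
  symm := ⟨fun a b h => ⟨h.1.symm, by rw [V.overlap_comm]; exact h.2⟩⟩
  loopless := ⟨fun _ h => h.1 rfl⟩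

/-- One coarsening step: merge the classes of `s` that lie in the same connected component of
`uniquenessGraph x s`. -/
noncomputable def coarsen (x : Fin n → EuclideanSpace ℝ (Fin d)) (s : Setoid (Fin m)) :
    Setoid (Fin m) :=
  Setoid.comap (Quotient.mk s) (V.uniquenessGraph x s).reachableSetoid

/-- The partition reached from the partition into singletons by `m` coarsening steps.  After that
many steps no further merging is possible, see `starGraph_eq_bot`. -/
noncomputable def starPartition (x : Fin n → EuclideanSpace ℝ (Fin d)) : Setoid (Fin m) :=
  (V.coarsen x)^[m] ⊥

/-- The vertices of the terminal graph: the classes of `starPartition`. -/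
abbrev StarVertex (x : Fin n → EuclideanSpace ℝ (Fin d)) : Type :=
  Quotient (V.starPartition x)

/-- The terminal graph of the coarsening procedure. -/
noncomputable def starGraph (x : Fin n → EuclideanSpace ℝ (Fin d)) :
    SimpleGraph (V.StarVertex x) :=
  V.uniquenessGraph x (V.starPartition x)

theorem card_coarsen_lt (x : Fin n → EuclideanSpace ℝ (Fin d)) (s : Setoid (Fin m))
    (h : V.uniquenessGraph x s ≠ ⊥) :
    Nat.card (Quotient (V.coarsen x s)) < Nat.card (Quotient s) := by
  classical
  obtain ⟨a, b, hab⟩ := SimpleGraph.ne_bot_iff_exists_adj.mp h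
  let f : Quotient s → Quotient (V.coarsen x s) :=
    Quotient.map' id fun i j hij => by
      change (V.uniquenessGraph x s).Reachable (Quotient.mk s i) (Quotient.mk s j)
      rw [Quotient.sound hij]
  have hf : Function.Surjective f := by
    rintro ⟨i⟩
    exact ⟨Quotient.mk s i, rfl⟩
  have hfab : f a = f b := by
    induction a using Quotient.inductionOn
    induction b using Quotient.inductionOn
    exact Quotient.sound (s := V.coarsen x s) hab.reachable
  refine lt_of_le_of_ne (Nat.card_le_card_of_surjective f hf) fun hc => ?_
  have := (Nat.bijective_iff_surjective_and_card f).mpr ⟨hf, hc.symm⟩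
  exact hab.ne (this.1 hfab)

/-- The coarsening procedure has terminated: no two vertices of `starGraph` can be merged. -/
theorem starGraph_eq_bot (x : Fin n → EuclideanSpace ℝ (Fin d)) : V.starGraph x = ⊥ := by
  by_contra hne
  have hstep : ∀ s, V.uniquenessGraph x s = ⊥ → V.coarsen x s = s := by
    intro s hs
    ext i j
    change (V.uniquenessGraph x s).Reachable (Quotient.mk s i) (Quotient.mk s j) ↔ _
    rw [hs, SimpleGraph.reachable_bot, Quotient.eq]
  have key : ∀ r ≤ m, V.uniquenessGraph x ((V.coarsen x)^[r] ⊥) ≠ ⊥ := by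
    intro r hr h0
    have : ∀ k, (V.coarsen x)^[r + k] ⊥ = (V.coarsen x)^[r] ⊥ := by
      intro k
      induction k with
      | zero => rfl
      | succ k ih =>
        rw [← add_assoc, Function.iterate_succ_apply', ih, hstep _ h0]
    have h1 := this (m - r)
    rw [Nat.add_sub_cancel' hr] at h1
    have tr : ∀ s s' : Setoid (Fin m), s = s' → V.uniquenessGraph x s' = ⊥ →
        V.uniquenessGraph x s = ⊥ := by
      rintro s _ rfl h
      exact h
    exact hne (tr _ _ h1 h0)
  have hcard : ∀ r ≤ m + 1, Nat.card (Quotient ((V.coarsen x)^[r] ⊥)) + r ≤ m := by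
    intro r
    induction r with
    | zero =>
      intro _
      have := Nat.card_le_card_of_surjective (Quotient.mk (⊥ : Setoid (Fin m)))
        Quotient.mk_surjective
      simpa using this
    | succ r ih =>
      intro hr
      have h1 := ih (by omega)
      have h2 := V.card_coarsen_lt x _ (key r (by omega))
      rw [Function.iterate_succ_apply']
      omega
  have := hcard (m + 1) le_rfl
  omega

end Views

/-! A second perfect alignment `O` places the points at positions `y`. Within view `i` both `x` and
`y` are rigid images of the same local coordinates, so `y k = R i (x k) + c i` with `R i = (O i)ᵀ S
i`. Points whose centred matrix has rank `d` affinely span the space, so two affine maps agreeing on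
them coincide (`affine_eq_of_le_rank`). Hence each merging step keeps `(R i, c i)` constant on
classes (`affine_eq_of_starPartition`). With a single class left, `R i` does not depend on `i`, and
`O i = S i (R i)ᵀ`. -/

/-- A square matrix that annihilates a matrix of full row rank is zero. -/
theorem Matrix.eq_zero_of_mul_eq_zero_of_le_rank {d : ℕ} {ι : Type*} [Fintype ι]
    (D : Matrix (Fin d) (Fin d) ℝ) (M : Matrix (Fin d) ι ℝ) (h : D * M = 0) (hM : d ≤ M.rank) :
    D = 0 := by
  have htop : LinearMap.range M.mulVecLin = ⊤ :=
    Submodule.eq_top_of_finrank_eq (le_antisymm (Submodule.finrank_le _) (by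
      simpa [Matrix.rank] using hM))
  refine Matrix.ext_of_mulVec_single fun j => ?_
  obtain ⟨w, hw⟩ : Pi.single j 1 ∈ LinearMap.range M.mulVecLin := htop ▸ Submodule.mem_top
  rw [← hw, Matrix.mulVecLin_apply, Matrix.mulVec_mulVec, h, Matrix.zero_mulVec,
    Matrix.zero_mulVec]

namespace Views

variable {d m n : ℕ} (V : Views d m n)

open Matrix

theorem alignmentError_eq_zero_iff (S : Fin m → Matrix.orthogonalGroup (Fin d) ℝ)
    (t : Fin m → EuclideanSpace ℝ (Fin d)) (x : Fin n → EuclideanSpace ℝ (Fin d)) :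
    V.alignmentError S t x = 0 ↔ ∀ k i, (k, i) ∈ V.edges →
      (S i : Matrix (Fin d) (Fin d) ℝ)ᵀ *ᵥ (V.coord k i).ofLp + (t i).ofLp = (x k).ofLp := by
  rw [alignmentError, Finset.sum_eq_zero_iff_of_nonneg fun _ _ => by positivity, Prod.forall]
  refine forall₂_congr fun k i => imp_congr_right fun _ => ?_
  rw [sq_eq_zero_iff, norm_eq_zero, sub_eq_zero, ← (WithLp.ofLp_injective 2).eq_iff]
  rfl

/-- Two affine maps that agree on points whose centred matrix has rank at least `d` are equal. -/
theorem affine_eq_of_le_rank {x : Fin n → EuclideanSpace ℝ (Fin d)} {P : Finset (Fin n)}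
    (hP : d ≤ (centredPointMatrix x P).rank) {R R' : Matrix (Fin d) (Fin d) ℝ}
    {c c' : Fin d → ℝ} (h : ∀ k ∈ P, R *ᵥ (x k).ofLp + c = R' *ᵥ (x k).ofLp + c') :
    R = R' ∧ c = c' := by
  rcases P.eq_empty_or_nonempty with rfl | hne
  -- Without points there is no mean to subtract, but the rank is then 0, which forces `d = 0`.
  · obtain rfl : d = 0 := by
      have := (centredPointMatrix x ∅).rank_le_card_width
      simp only [Fintype.card_coe, Finset.card_empty] at this
      omega
    exact ⟨Subsingleton.elim _ _, Subsingleton.elim _ _⟩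
  have hcard : (P.card : ℝ) ≠ 0 := by simpa using hne.ne_empty
  -- `R - R'` takes the same value at every point of `P`, hence also at their mean, so it kills each
  -- centred column.
  have hdiff : ∀ k ∈ P, (R - R') *ᵥ (x k).ofLp = c' - c := fun k hk => by
    rw [Matrix.sub_mulVec, sub_eq_sub_iff_add_eq_add, h k hk, add_comm]
  have hcol : ∀ k : P, (fun a => centredPointMatrix x P a k)
      = (x k).ofLp - (1 / (P.card : ℝ)) • ∑ l ∈ P, (x l).ofLp := fun k => by
    ext a
    simp [centredPointMatrix]
  have hR : R = R' := by
    rw [← sub_eq_zero]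
    refine Matrix.eq_zero_of_mul_eq_zero_of_le_rank _ _ ?_ hP
    ext a k
    change ((R - R') *ᵥ fun b => centredPointMatrix x P b k) a = 0
    rw [hcol, Matrix.mulVec_sub, Matrix.mulVec_smul, Matrix.mulVec_sum, hdiff k k.2,
      Finset.sum_congr rfl hdiff, Finset.sum_const, ← Nat.cast_smul_eq_nsmul ℝ, smul_smul,
      one_div_mul_cancel hcard, one_smul, sub_self, Pi.zero_apply]
  subst hR
  obtain ⟨k, hk⟩ := hne
  exact ⟨rfl, add_left_cancel (h k hk)⟩

/-- If the motion of the aligned points is affine on each view, then views in a common class of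
`starPartition` move by the same affine map. -/
theorem affine_eq_of_starPartition {x : Fin n → EuclideanSpace ℝ (Fin d)}
    {y : Fin n → Fin d → ℝ} {R : Fin m → Matrix (Fin d) (Fin d) ℝ} {c : Fin m → Fin d → ℝ}
    (h : ∀ k i, (k, i) ∈ V.edges → R i *ᵥ (x k).ofLp + c i = y k) {i j : Fin m}
    (hij : V.starPartition x i j) : R i = R j ∧ c i = c j := by
  have hstep : ∀ s : Setoid (Fin m), (∀ i j, s i j → R i = R j ∧ c i = c j) →
      ∀ i j, V.coarsen x s i j → R i = R j ∧ c i = c j := by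
    intro s hs i j hij
    -- The induction hypothesis makes the affine map a function of the class. Translations are
    -- included because agreement on an overlap concerns whole affine maps.
    let g : Quotient s → Matrix (Fin d) (Fin d) ℝ × (Fin d → ℝ) :=
      Quotient.lift (fun i => (R i, c i)) fun i j hij => Prod.ext_iff.mpr (hs i j hij)
    have hadj : ∀ a b, (V.uniquenessGraph x s).Adj a b → g a = g b := by
      rintro a b ⟨-, hrank⟩
      refine Prod.ext_iff.mpr (affine_eq_of_le_rank hrank fun k hk => ?_)
      simp only [overlap, Finset.mem_filter, Finset.mem_univ, true_and] at hk
      -- The views `i` and `j` may vary with the point `k`; this is harmless since `g` depends only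
      -- on their classes.
      obtain ⟨⟨i, rfl, hi⟩, j, rfl, hj⟩ := hk
      exact (h k i hi).trans (h k j hj).symm
    have hwalk : ∀ a b, (V.uniquenessGraph x s).Reachable a b → g a = g b := by
      rintro a b ⟨w⟩
      induction w with
      | nil => rfl
      | cons hab _ ih => exact (hadj _ _ hab).trans ih
    exact Prod.ext_iff.mp (hwalk (Quotient.mk s i) (Quotient.mk s j) hij)
  have hiter : ∀ r i j, ((V.coarsen x)^[r] ⊥) i j → R i = R j ∧ c i = c j := by
    intro r
    induction r with
    | zero =>
      rintro i _ rfl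
      exact ⟨rfl, rfl⟩
    | succ r ih =>
      rw [Function.iterate_succ_apply']
      exact hstep _ ih
  exact hiter m i j hij

end Views

/-- If `S` is a perfect alignment and the terminal graph of the coarsening procedure, built from
(any choice of) the aligned points `x` of `S`, has a single vertex, then `S` is unique up to a
global orthogonal transformation. -/
theorem mainTheorem5 {d m n : ℕ} (V : Views d m n)
    (S : Fin m → Matrix.orthogonalGroup (Fin d) ℝ) (hS : V.IsPerfectAlignment S)
    (t : Fin m → EuclideanSpace ℝ (Fin d)) (x : Fin n → EuclideanSpace ℝ (Fin d))
    (hx : V.IsOptimalRealization S t x)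
    (hG : Nat.card (V.StarVertex x) = 1) :
    V.IsUniquePerfectAlignment S := by
  refine ⟨hS, fun O hO => ?_⟩
  -- The infimum 0 is attained, so `O` fits all the data exactly.
  obtain ⟨u, y, huy⟩ := V.exists_isOptimalRealization O
  have hx' := (V.alignmentError_eq_zero_iff S t x).mp (hx.trans hS)
  have hy' := (V.alignmentError_eq_zero_iff O u y).mp (huy.trans hO)
  -- Eliminating the local coordinates gives `y k = (O i)ᵀ S i (x k - t i) + u i`.
  let R : Fin m → Matrix.orthogonalGroup (Fin d) ℝ := fun i => star (O i) * S i
  have haff : ∀ k i, (k, i) ∈ V.edges →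
      (R i : Matrix (Fin d) (Fin d) ℝ).mulVec (x k).ofLp
        + ((u i).ofLp - (R i : Matrix (Fin d) (Fin d) ℝ).mulVec (t i).ofLp) = (y k).ofLp := by
    intro k i hki
    have hRS : (R i : Matrix (Fin d) (Fin d) ℝ) * (S i : Matrix (Fin d) (Fin d) ℝ).transpose
        = (O i : Matrix (Fin d) (Fin d) ℝ).transpose :=
      congrArg Subtype.val (show star (O i) * S i * star (S i) = star (O i) by
        rw [mul_assoc, Unitary.mul_star_self, mul_one])
    rw [← hx' k i hki, ← hy' k i hki, Matrix.mulVec_add, Matrix.mulVec_mulVec, hRS]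
    abel
  obtain ⟨hsub, ⟨q⟩⟩ := Nat.card_eq_one_iff_unique.mp hG
  induction q using Quotient.inductionOn with | _ i₀
  refine ⟨star (R i₀), fun i => ?_⟩
  have hR : R i = R i₀ := Subtype.ext (V.affine_eq_of_starPartition haff
    (Quotient.exact (hsub.elim (Quotient.mk _ i) (Quotient.mk _ i₀)))).1
  rw [← hR, star_mul, star_star, ← mul_assoc, Unitary.mul_star_self, one_mul]
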